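/- \textbf{Setting.} Let $K\ge 0$ be an integer, $\hat s\in\mathbb R$, $\bar a_k,\bar b_k\in\mathbb R^3$, $\delta_k>0$ for $k=1,\dots,K$, and $\bar c\in\mathbb R$. For $v\in\mathbb R^3$ write $\hat v=[v^{\mathsf T}\ 0]^{\mathsf T}\in\mathbb R^4$, and let $\Omega_1(p),\Omega_2(p)\in\mathbb R^{4\times4}$ be the matrices of left and right quaternion multiplication by $p$ (so $p\circ q=\Omega_1(p)q$ and $q\circ p=\Omega_2(p)q$, the scalar part of a quaternion being its last entry). Put $$N_k=(\|\bar b_k\|^2+\|\hat s\bar a_k\|^2)I_4+2\,\Omega_1(\hat b_k)\,\Omega_2(\hat a_k),\qquad \hat a_k=[\hat s\bar a_k^{\mathsf T}\ 0]^{\mathsf T},\quad \hat b_k=[\bar b_k^{\mathsf T}\ 0]^{\mathsf T},$$ $$Q_{kk}=\frac{1}{2\delta_k^2}N_k+\frac{\bar c^2}{2}I_4,\qquad Q_{0k}=\frac{1}{4\delta_k^2}N_k-\frac{\bar c^2}{4}I_4,$$ and let $Q\in\mathbb R^{4(K+1)\times4(K+1)}$ be the symmetric matrix with $4\times4$ blocks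 (indexed by $0,\dots,K$) $[Q]_{kk}=Q_{kk}$, $[Q]_{0k}=[Q]_{k0}=Q_{0k}$ for $k=1,\dots,K$, and all other blocks zero. For $x=[q^{\mathsf T},q_1^{\mathsf T},\dots,q_K^{\mathsf T}]^{\mathsf T}\in\mathbb R^{4(K+1)}$ consider the binary-cloning QCQP $$\min_{x}\ x^{\mathsf T}Qx\quad\text{s.t.}\quad q^{\mathsf T}q=1,\quad q_kq_k^{\mathsf T}=qq^{\mathsf T}\ (k=1,\dots,K),\tag{P}$$ and its SDP relaxation with redundant constraints $$\min_{Z\succeq0}\ \operatorname{tr}(QZ)\quad\text{s.t.}\quad \operatorname{tr}([Z]_{00})=1,\quad [Z]_{kk}=[Z]_{00}\ (1\le k\le K),\quad [Z]_{ij}=[Z]_{ij}^{\mathsf T}\ (0\le i<j\le K).\tag{R}$$ \textbf{Theorem (Global Optimality Guarantee).} Let $Z^\star$ be an optimal solution of (R) with $\operatorname{rank}(Z^\star)=1$. Then: \begin{enumerate} \item the optimal costs of (R) and of (P) are both attained and are equal; \item $Z^\star=x^\star(x^\star)^{\mathsf T}$ for some $x^\star=[(q^\star)^{\mathsf T},(q_1^\star)^{\mathsf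 T},\dots,(q_K^\star)^{\mathsf T}]^{\mathsf T}$ with $\|q^\star\|=1$, $q_k^\star=\theta_k^\star q^\star$ and $\theta_k^\star\in\{\pm1\}$; \item for this $x^\star$, the two distinct points $\pm x^\star$ are global minimizers of (P); and if $Z^\star$ is \emph{the} optimal solution of (R), i.e. (R) has no other optimal solution, then $\pm x^\star$ are the only global minimizers of (P). \end{enumerate} -/

import Mathlib

open Matrix

namespace RobustRotation

/-- Quaternions `[q₁ q₂ q₃ q₄]`, vector part first and scalar part last. -/
abbrev Quat := Fin 4 → ℝ

/-- The space `ℝ^{4(K+1)}` of stacked quaternions; the coordinate `(i, r)` is the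
`r`-th entry of the `i`-th quaternion, and block `0` is the distinguished quaternion `q`. -/
abbrev Stack (K : ℕ) := Fin (K + 1) × Fin 4 → ℝ

/-- Real matrices of size `4(K+1) × 4(K+1)`, partitioned in `4 × 4` blocks. -/
abbrev BlockMat (K : ℕ) := Matrix (Fin (K + 1) × Fin 4) (Fin (K + 1) × Fin 4) ℝ

/-- The matrix of the left quaternion product: `p ∘ q = Ω₁(p) q`. -/
def Omega1 (q : Quat) : Matrix (Fin 4) (Fin 4) ℝ :=
  !![ q 3, -q 2,  q 1, q 0;
      q 2,  q 3, -q 0, q 1;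
     -q 1,  q 0,  q 3, q 2;
     -q 0, -q 1, -q 2, q 3]

/-- The matrix of the right quaternion product: `p ∘ q = Ω₂(q) p`. -/
def Omega2 (q : Quat) : Matrix (Fin 4) (Fin 4) ℝ :=
  !![ q 3,  q 2, -q 1, q 0;
     -q 2,  q 3,  q 0, q 1;
      q 1, -q 0,  q 3, q 2;
     -q 0, -q 1, -q 2, q 3]

/-- The homogenization `[vᵀ 0]ᵀ` of a vector of `ℝ³`. -/
def homog (v : EuclideanSpace ℝ (Fin 3)) : Quat := ![v 0, v 1, v 2, 0]

/-- The matrix `(‖b‖² + ‖a‖²) I₄ + 2 Ω₁(b̂) Ω₂(â)`. -/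
noncomputable def residualBlock (a b : EuclideanSpace ℝ (Fin 3)) : Matrix (Fin 4) (Fin 4) ℝ :=
  (‖b‖ ^ 2 + ‖a‖ ^ 2) • (1 : Matrix (Fin 4) (Fin 4) ℝ)
    + (2 : ℝ) • (Omega1 (homog b) * Omega2 (homog a))

/-- The diagonal data block `Q_{kk}` (the vector `a` is already scaled). -/
noncomputable def diagBlock (a b : EuclideanSpace ℝ (Fin 3)) (δ c : ℝ) :
    Matrix (Fin 4) (Fin 4) ℝ :=
  (1 / (2 * δ ^ 2)) • residualBlock a b + (c ^ 2 / 2) • (1 : Matrix (Fin 4) (Fin 4) ℝ)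

/-- The off-diagonal data block `Q_{0k}` (the vector `a` is already scaled). -/
noncomputable def offDiagBlock (a b : EuclideanSpace ℝ (Fin 3)) (δ c : ℝ) :
    Matrix (Fin 4) (Fin 4) ℝ :=
  (1 / (4 * δ ^ 2)) • residualBlock a b - (c ^ 2 / 4) • (1 : Matrix (Fin 4) (Fin 4) ℝ)

/-- The matrix `Q_k`: block `D` at `(k, k)`, block `E` at `(0, k)` and `(k, 0)`, zero elsewhere.
Measurement `k : Fin K` corresponds to the block index `k.succ`. -/
def placeBlocks {K : ℕ} (k : Fin K) (D E : Matrix (Fin 4) (Fin 4) ℝ) : BlockMat K :=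
  Matrix.of fun u v =>
    if u.1 = k.succ ∧ v.1 = k.succ then D u.2 v.2
    else if (u.1 = 0 ∧ v.1 = k.succ) ∨ (u.1 = k.succ ∧ v.1 = 0) then E u.2 v.2
    else 0

/-- The cost matrix `Q = ∑ₖ Q_k` of the binary-cloning QCQP, for the scale `s`, the measurements
`a k`, `b k`, the noise bounds `δ k` and the truncation parameter `c`. -/
noncomputable def costMatrix {K : ℕ} (s : ℝ) (a b : Fin K → EuclideanSpace ℝ (Fin 3))
    (δ : Fin K → ℝ) (c : ℝ) : BlockMat K :=
  ∑ k, placeBlocks k (diagBlock (s • a k) (b k) (δ k) c) (offDiagBlock (s • a k) (b k) (δ k) c)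

/-- The `i`-th quaternion of a stacked vector. -/
def subvec {K : ℕ} (x : Stack K) (i : Fin (K + 1)) : Quat := fun r => x (i, r)

/-- The `(i, j)` block, of size `4 × 4`. -/
def block {K : ℕ} (Z : BlockMat K) (i j : Fin (K + 1)) : Matrix (Fin 4) (Fin 4) ℝ :=
  Matrix.of fun r t => Z (i, r) (j, t)

/-- The stacked vector `[qᵀ, q₁ᵀ, …, q_Kᵀ]ᵀ`. -/
def stack {K : ℕ} (q : Quat) (qs : Fin K → Quat) : Stack K :=
  fun p => (Fin.cons q qs : Fin (K + 1) → Quat) p.1 p.2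

/-- The feasible set of the QCQP: `x_qᵀ x_q = 1` and `x_{q_k} x_{q_k}ᵀ = x_q x_qᵀ`. -/
def qcqpFeasible (K : ℕ) : Set (Stack K) :=
  {x | subvec x 0 ⬝ᵥ subvec x 0 = 1 ∧
    ∀ k : Fin K, vecMulVec (subvec x k.succ) (subvec x k.succ)
      = vecMulVec (subvec x 0) (subvec x 0)}

/-- The cost `xᵀ Q x`. -/
def qcqpCost {K : ℕ} (Q : BlockMat K) (x : Stack K) : ℝ := x ⬝ᵥ (Q *ᵥ x)

/-- The feasible set of the SDP relaxation with redundant constraints. -/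
def sdpFeasible (K : ℕ) : Set (BlockMat K) :=
  {Z | Z.PosSemidef ∧ (block Z 0 0).trace = 1 ∧
    (∀ k : Fin K, block Z k.succ k.succ = block Z 0 0) ∧
    ∀ i j : Fin (K + 1), i < j → block Z i j = (block Z i j)ᵀ}

/-- The cost `tr(Q Z)`. -/
def sdpCost {K : ℕ} (Q Z : BlockMat K) : ℝ := (Q * Z).trace

/-- `x` is an optimal solution (a global minimizer) of `f` over the feasible set `S`. -/
def IsOptimal {α : Type*} (f : α → ℝ) (S : Set α) (x : α) : Prop :=
  x ∈ S ∧ ∀ y ∈ S, f x ≤ f y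

/-- `μ` is the optimal cost, attained, of minimizing `f` over the feasible set `S`. -/
def IsOptimalCost {α : Type*} (f : α → ℝ) (S : Set α) (μ : ℝ) : Prop :=
  IsLeast (f '' S) μ

end RobustRotation

open RobustRotation

namespace RobustRotation

/-! The map `x ↦ vecMulVec x x` carries the QCQP into the relaxation, preserving cost
(`sdpCost_vecMulVec`), and a rank-one matrix in its image is feasible iff its vector is
(`vecMulVec_mem_sdpFeasible_iff`). A rank-one optimum has the form `vecMulVec x x`, so the
relaxation is tight and `x` is optimal. The fibres of the map are pairs `{x, -x}`, so uniqueness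
upstairs gives uniqueness up to sign. None of this depends on the entries of the cost matrix. -/

/-- Two real vectors with the same outer product agree up to sign. -/
theorem exists_sign_of_vecMulVec_self_eq {ι : Type*} {x y : ι → ℝ}
    (h : vecMulVec x x = vecMulVec y y) :
    ∃ θ : ℝ, (θ = 1 ∨ θ = -1) ∧ x = θ • y := by
  have hmul : ∀ i j, x i * x j = y i * y j := fun i j => by
    simpa [vecMulVec_apply] using congrFun (congrFun h i) j
  by_cases hy : y = 0
  · refine ⟨1, Or.inl rfl, funext fun i => ?_⟩
    have := hmul i i
    simpa [hy] using this
  -- The sign is read off at one nonzero coordinate `p`; cancelling `y p` propagates it to all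
  -- others.
  · obtain ⟨p, hp⟩ := Function.ne_iff.mp hy
    rw [Pi.zero_apply] at hp
    rcases mul_self_eq_mul_self_iff.mp (hmul p p) with e | e
    · refine ⟨1, Or.inl rfl, funext fun i => mul_right_cancel₀ hp ?_⟩
      simpa [e] using hmul i p
    · refine ⟨-1, Or.inr rfl, funext fun i => mul_right_cancel₀ hp ?_⟩
      have := hmul i p
      simp only [e, Pi.smul_apply, smul_eq_mul] at this ⊢
      linarith

/-- The points feasible for the QCQP are the stacks `(q, θ₁ q, …, θ_K q)` with `‖q‖ = 1` and
`θ k = ±1`. -/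
theorem exists_eq_stack_of_mem_qcqpFeasible {K : ℕ} {x : Stack K} (hx : x ∈ qcqpFeasible K) :
    ∃ (q : Quat) (θ : Fin K → ℝ), q ⬝ᵥ q = 1 ∧ (∀ k, θ k = 1 ∨ θ k = -1) ∧
      x = stack q (fun k => θ k • q) := by
  choose θ hθ hx' using fun k => exists_sign_of_vecMulVec_self_eq (hx.2 k)
  refine ⟨subvec x 0, θ, hx.1, hθ, ?_⟩
  ext ⟨i, r⟩
  refine Fin.cases ?_ (fun k => ?_) i
  · simp [stack, subvec]
  · simpa [stack, subvec] using congrFun (hx' k) r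

theorem block_vecMulVec {K : ℕ} (x : Stack K) (i j : Fin (K + 1)) :
    block (vecMulVec x x) i j = vecMulVec (subvec x i) (subvec x j) := rfl

/-- An outer product is feasible for the relaxation exactly when the vector is feasible for the
QCQP. -/
theorem vecMulVec_mem_sdpFeasible_iff {K : ℕ} {x : Stack K} :
    vecMulVec x x ∈ sdpFeasible K ↔ x ∈ qcqpFeasible K := by
  constructor
  · rintro ⟨-, htr, hd, -⟩
    refine ⟨?_, fun k => by simpa only [block_vecMulVec] using hd k⟩
    rwa [block_vecMulVec, trace_vecMulVec] at htr
  · intro hx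
    refine ⟨?_, ?_, hx.2, fun i j _ => ?_⟩
    · simpa using posSemidef_vecMulVec_self_star x
    · rw [block_vecMulVec, trace_vecMulVec]; exact hx.1
    -- The redundant constraints hold because all subvectors are multiples of one `q`: every block
    -- is a multiple of the symmetric `vecMulVec q q`.
    · obtain ⟨q, θ, -, -, rfl⟩ := exists_eq_stack_of_mem_qcqpFeasible hx
      have hs : ∀ i, ∃ t : ℝ, subvec (stack q fun k => θ k • q) i = t • q := fun i =>
        Fin.cases ⟨1, by ext r; simp [subvec, stack]⟩
          (fun k => ⟨θ k, by ext r; simp [subvec, stack]⟩) i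
      obtain ⟨t, ht⟩ := hs i
      obtain ⟨u, hu⟩ := hs j
      rw [block_vecMulVec, ht, hu]
      ext r v
      simp only [vecMulVec_apply, transpose_apply, Pi.smul_apply, smul_eq_mul]
      ring

theorem sdpCost_vecMulVec {K : ℕ} (Q : BlockMat K) (x : Stack K) :
    sdpCost Q (vecMulVec x x) = qcqpCost Q x := by
  rw [sdpCost, qcqpCost, mul_vecMulVec, trace_vecMulVec, dotProduct_comm]

/-- The range is a line spanned by `u`; `v j` is the coefficient of column `j` along `u`. -/
theorem exists_eq_vecMulVec_of_rank_eq_one {m n : Type*} [Fintype m] [Fintype n]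
    [DecidableEq n] {Z : Matrix m n ℝ} (h : Z.rank = 1) :
    ∃ u v, Z = vecMulVec u v := by
  obtain ⟨u, -, hu⟩ := finrank_eq_one_iff'.mp h
  choose v hv using fun j => hu ⟨Z.mulVecLin (Pi.single j 1), LinearMap.mem_range_self _ _⟩
  refine ⟨u, v, ?_⟩
  ext i j
  have := congrFun (congrArg Subtype.val (hv j)) i
  simp at this
  rw [vecMulVec_apply, ← this, mul_comm]

/-- A positive semidefinite real matrix of rank one is the outer product of a vector with
itself. -/
theorem exists_eq_vecMulVec_self_of_posSemidef {n : Type*} [Fintype n] [DecidableEq n]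
    {Z : Matrix n n ℝ} (hZ : Z.PosSemidef) (h : Z.rank = 1) :
    ∃ x, Z = vecMulVec x x := by
  obtain ⟨u, v, huv⟩ := exists_eq_vecMulVec_of_rank_eq_one h
  have hent : ∀ i j, Z i j = u i * v j := fun i j => by rw [huv, vecMulVec_apply]
  have hsymm : ∀ i j, Z i j = Z j i := fun i j => by simpa using (hZ.1.apply i j).symm
  have hne : ∃ p, Z p p ≠ 0 := by
    by_contra! hall
    have : Z = 0 := by
      ext i j
      -- By symmetry and vanishing 2×2 minors, `Z i j ^ 2 = Z i i * Z j j`.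
      have hsq : Z i j * Z i j = 0 := by
        nth_rw 2 [hsymm]
        have := hall i
        rw [hent] at this
        rw [hent, hent]
        linear_combination (u j * v j) * this
      simpa using hsq
    rw [this, rank_zero] at h
    exact zero_ne_one h
  obtain ⟨p, hp⟩ := hne
  have hpos : 0 < Z p p := lt_of_le_of_ne hZ.diag_nonneg (Ne.symm hp)
  -- If `Z = vecMulVec x x`, column `p` is `x p • x` and `√(Z p p) = |x p|`, so this recovers `x` up
  -- to sign.
  refine ⟨fun i => Z i p / √(Z p p), ?_⟩
  ext i j
  rw [vecMulVec_apply, div_mul_div_comm, Real.mul_self_sqrt hpos.le, eq_div_iff hp, hsymm j p]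
  simp only [hent]
  ring

end RobustRotation

theorem mainTheorem2 (K : ℕ) (s : ℝ) (a b : Fin K → EuclideanSpace ℝ (Fin 3))
    (δ : Fin K → ℝ) (hδ : ∀ k, 0 < δ k) (c : ℝ)
    (Zstar : BlockMat K)
    (hZ : IsOptimal (sdpCost (costMatrix s a b δ c)) (sdpFeasible K) Zstar)
    (hrank : Zstar.rank = 1) :
    (∃ μ : ℝ, IsOptimalCost (sdpCost (costMatrix s a b δ c)) (sdpFeasible K) μ ∧
      IsOptimalCost (qcqpCost (costMatrix s a b δ c)) (qcqpFeasible K) μ) ∧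
    ∃ (qstar : Quat) (θ : Fin K → ℝ) (xstar : Stack K),
      qstar ⬝ᵥ qstar = 1 ∧
      (∀ k, θ k = 1 ∨ θ k = -1) ∧
      xstar = stack qstar (fun k => θ k • qstar) ∧
      Zstar = vecMulVec xstar xstar ∧
      xstar ≠ -xstar ∧
      IsOptimal (qcqpCost (costMatrix s a b δ c)) (qcqpFeasible K) xstar ∧
      IsOptimal (qcqpCost (costMatrix s a b δ c)) (qcqpFeasible K) (-xstar) ∧
      ((∀ Z, IsOptimal (sdpCost (costMatrix s a b δ c)) (sdpFeasible K) Z → Z = Zstar) →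
        {x | IsOptimal (qcqpCost (costMatrix s a b δ c)) (qcqpFeasible K) x}
          = {xstar, -xstar}) := by
  generalize costMatrix s a b δ c = Q at hZ ⊢
  obtain ⟨x, rfl⟩ := exists_eq_vecMulVec_self_of_posSemidef hZ.1.1 hrank
  have hx : x ∈ qcqpFeasible K := vecMulVec_mem_sdpFeasible_iff.mp hZ.1
  have hopt : ∀ y, vecMulVec y y = vecMulVec x x → IsOptimal (qcqpCost Q) (qcqpFeasible K) y := by
    intro y hy
    refine ⟨vecMulVec_mem_sdpFeasible_iff.mp (hy ▸ hZ.1), fun z hz => ?_⟩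
    rw [← sdpCost_vecMulVec, ← sdpCost_vecMulVec, hy]
    exact hZ.2 _ (vecMulVec_mem_sdpFeasible_iff.mpr hz)
  have hxopt := hopt x rfl
  have hneg : IsOptimal (qcqpCost Q) (qcqpFeasible K) (-x) :=
    hopt (-x) (by simp [neg_vecMulVec, vecMulVec_neg])
  refine ⟨⟨qcqpCost Q x, ⟨⟨_, hZ.1, sdpCost_vecMulVec Q x⟩, ?_⟩,
    ⟨⟨x, hx, rfl⟩, ?_⟩⟩, ?_⟩
  · rintro _ ⟨Z, hZ', rfl⟩
    exact sdpCost_vecMulVec Q x ▸ hZ.2 Z hZ'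
  · rintro _ ⟨y, hy, rfl⟩
    exact hxopt.2 y hy
  obtain ⟨q, θ, hq, hθ, hxq⟩ := exists_eq_stack_of_mem_qcqpFeasible hx
  refine ⟨q, θ, x, hq, hθ, hxq, rfl, fun h => ?_, hxopt, hneg, fun huniq => ?_⟩
  · have hx0 : subvec x 0 = 0 := funext fun r => self_eq_neg.mp (congrFun h (0, r))
    have := hx.1
    simp [hx0] at this
  · ext y
    simp only [Set.mem_ofPred_eq, Set.mem_insert_iff, Set.mem_singleton_iff]
    constructor
    · intro hy
      -- By tightness, the lift of any QCQP minimizer is optimal for the relaxation.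
      have hyZ : vecMulVec y y = vecMulVec x x := by
        refine huniq _ ⟨vecMulVec_mem_sdpFeasible_iff.mpr hy.1, fun Z hZ' => ?_⟩
        rw [sdpCost_vecMulVec]
        exact (hy.2 x hx).trans (sdpCost_vecMulVec Q x ▸ hZ.2 Z hZ')
      obtain ⟨t, rfl | rfl, rfl⟩ := exists_sign_of_vecMulVec_self_eq hyZ
      · exact Or.inl (one_smul ℝ x)
      · exact Or.inr (neg_one_smul ℝ x)
    · rintro (rfl | rfl)
      · exact hxopt
      · exact hneg
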